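/- Let $\mathcal H$ be a complex Hilbert space and let $A,B,C,D$ be bounded linear operators on $\mathcal H$. For a bounded linear operator $T$ on $\mathcal H$ let $T^*$ be its adjoint, $|T|=(T^*T)^{1/2}$, $\|T\|$ its operator norm and $w(T)=\sup\{|\langle Tx,x\rangle| : x\in\mathcal H,\ \|x\|=1\}$ its numerical radius; for $s\ge 0$ the power $|T|^{s}$ is given by the continuous functional calculus, with $|T|^{0}=I$. Then, for each of the two choices of the sign, $$ w(AB\pm CD)\le \frac14\Big(\inf_{t\in[0,1]}\big\||A|^{2t}+|B^*|^{2t}\big\|\,\big\||A^*|^{2(1-t)}+|B|^{2(1-t)}\big\| +\inf_{t\in[0,1]}\big\||C|^{2t}+|D^*|^{2t}\big\|\,\big\||C^*|^{2(1-t)}+|D|^{2(1-t)}\big\|\Big). $$ -/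

import Mathlib

/-- The numerical radius `w(T) = sup {|⟨T x, x⟩| : ‖x‖ = 1}` of a bounded operator. The set is
bounded above by `‖T‖`; on the zero space it is empty and the value is `0`. -/
noncomputable def numericalRadius {H : Type*} [NormedAddCommGroup H] [InnerProductSpace ℂ H]
    (T : H →L[ℂ] H) : ℝ :=
  sSup {r : ℝ | ∃ x : H, ‖x‖ = 1 ∧ r = ‖inner ℂ (T x) x‖}

theorem numericalRadius_bddAbove {H : Type*} [NormedAddCommGroup H] [InnerProductSpace ℂ H]
    (T : H →L[ℂ] H) : BddAbove {r : ℝ | ∃ x : H, ‖x‖ = 1 ∧ r = ‖inner ℂ (T x) x‖} := by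
  refine ⟨‖T‖, ?_⟩
  rintro r ⟨x, hx, rfl⟩
  have h1 := norm_inner_le_norm (𝕜 := ℂ) (T x) x
  have h2 := T.le_opNorm x
  rw [hx, mul_one] at h1 h2
  exact h1.trans h2

/-!
For unit `x`, rotating `B` by a phase `c` and polarizing gives
`4 |⟨A B x, x⟩| = 4 re ⟨A⋆ x, c B x⟩ ≤ ‖A⋆ + c B‖²`. So everything reduces to
`‖S + T‖² ≤ ‖|S|^(2p) + |T|^(2p)‖ ‖|S⋆|^(2q) + |T⋆|^(2q)‖` for `p + q = 1`, which follows by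
Cauchy–Schwarz from the mixed Schwarz inequality
`|⟨T x, y⟩|² ≤ ⟨F(T⋆T) x, x⟩ ⟨G(TT⋆) y, y⟩` with `F(u) G(u) ≥ u`. For `G > 0` the latter is the
Cauchy–Schwarz inequality weighted by `G(TT⋆)`, because `T⋆ G(TT⋆)⁻¹ T = (u / G(u))(T⋆T) ≤ F(T⋆T)`.
-/

open RCLike Set
open scoped InnerProductSpace

section ContinuousFunctionalCalculus

theorem semiconjBy_cfc {𝕜 R : Type*} {p : R → Prop} [RCLike 𝕜] [Ring R] [StarRing R] [Algebra 𝕜 R]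
    [TopologicalSpace R] [ContinuousFunctionalCalculus 𝕜 R p] [IsTopologicalRing R] [T2Space R]
    {x a b : R} (ha : p a) (hb : p b) (h : SemiconjBy x a b)
    (h_star : SemiconjBy x (star a) (star b)) {f : 𝕜 → 𝕜}
    (hf : ContinuousOn f (spectrum 𝕜 a ∪ spectrum 𝕜 b)) :
    SemiconjBy x (cfc f a) (cfc f b) := by
  set s := spectrum 𝕜 a ∪ spectrum 𝕜 b
  have hsa : spectrum 𝕜 a ⊆ s := subset_union_left
  have hsb : spectrum 𝕜 b ⊆ s := subset_union_right
  have : CompactSpace s := isCompact_iff_compactSpace.mp <|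
    (ContinuousFunctionalCalculus.isCompact_spectrum a).union
      (ContinuousFunctionalCalculus.isCompact_spectrum b)
  have semiconj_hom (g : C(s, 𝕜)) :
      SemiconjBy x (cfcHomSuperset ha hsa g) (cfcHomSuperset hb hsb g) := by
    induction g using ContinuousMap.induction_on_of_compact with
    | const r =>
      have hr : ContinuousMap.const s r = algebraMap 𝕜 _ r := rfl
      rw [hr, AlgHomClass.commutes, AlgHomClass.commutes]
      exact Algebra.commute_algebraMap_right r x
    | id => rwa [cfcHomSuperset_id, cfcHomSuperset_id]
    | star_id => rwa [map_star, map_star, cfcHomSuperset_id, cfcHomSuperset_id]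
    | add f g hf hg => rw [map_add, map_add]; exact hf.add_right hg
    | mul f g hf hg => rw [map_mul, map_mul]; exact hf.mul_right hg
    | frequently f hf =>
      have h_closed : IsClosed {g : C(s, 𝕜) |
          x * cfcHomSuperset ha hsa g = cfcHomSuperset hb hsb g * x} :=
        isClosed_eq (continuous_const.mul (cfcHomSuperset_continuous ha hsa))
          ((cfcHomSuperset_continuous hb hsb).mul continuous_const)
      exact h_closed.closure_subset (mem_closure_iff_frequently.mpr hf)
  rw [cfc_apply f a ha (hf.mono hsa), cfc_apply f b hb (hf.mono hsb)]
  exact semiconj_hom ⟨_, hf.domRestrict⟩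

theorem star_mul_cfc_mul_star_mul_self {R : Type*} [Ring R] [StarRing R] [Algebra ℝ R]
    [TopologicalSpace R] [ContinuousFunctionalCalculus ℝ R IsSelfAdjoint] [IsTopologicalRing R]
    [T2Space R] (x : R) {f : ℝ → ℝ}
    (hf : ContinuousOn f (spectrum ℝ (star x * x) ∪ spectrum ℝ (x * star x))) :
    star x * cfc f (x * star x) * x = cfc (fun u => u * f u) (star x * x) := by
  have ha := IsSelfAdjoint.star_mul_self x
  have hb := IsSelfAdjoint.mul_star_self x
  have h : SemiconjBy x (star x * x) (x * star x) := (mul_assoc x (star x) x).symm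
  have h_comm := semiconjBy_cfc ha hb h (by rwa [ha.star_eq, hb.star_eq]) hf
  rw [cfc_mul (fun u => u) f _ continuousOn_id (hf.mono subset_union_left), cfc_id' ℝ (star x * x),
    mul_assoc, ← h_comm.eq, mul_assoc]

theorem abs_rpow_two_mul {R : Type*} [CStarAlgebra R] [PartialOrder R] [StarOrderedRing R]
    (a : R) {t : ℝ} (ht : 0 ≤ t) :
    CFC.abs a ^ (2 * t) = cfc (fun u : ℝ => u ^ t) (star a * a) := by
  lift t to NNReal using ht
  rw [← CFC.rpow_eq_cfc_real (star_mul_self_nonneg a)]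
  simpa [CFC.abs] using CFC.rpow_sqrt_nnreal (x := 2 * t) (star_mul_self_nonneg a)

end ContinuousFunctionalCalculus

section InnerProduct

variable {𝕜 E : Type*} [RCLike 𝕜] [NormedAddCommGroup E] [InnerProductSpace 𝕜 E]

theorem reApplyInnerSelf_nonneg {T : E →L[𝕜] E} (hT : 0 ≤ T) (x : E) : 0 ≤ T.reApplyInnerSelf x :=
  ((ContinuousLinearMap.nonneg_iff_isPositive T).mp hT).re_inner_nonneg_left x

theorem reApplyInnerSelf_mono {S T : E →L[𝕜] E} (h : S ≤ T) (x : E) :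
    S.reApplyInnerSelf x ≤ T.reApplyInnerSelf x := by
  have := ((ContinuousLinearMap.le_def S T).mp h).re_inner_nonneg_left x
  simpa [ContinuousLinearMap.reApplyInnerSelf_apply, inner_sub_left] using this

theorem sum_reApplyInnerSelf {ι : Type*} (s : Finset ι) (T : ι → E →L[𝕜] E) (x : E) :
    ∑ i ∈ s, (T i).reApplyInnerSelf x = (∑ i ∈ s, T i).reApplyInnerSelf x := by
  simp [ContinuousLinearMap.reApplyInnerSelf_apply, sum_inner]

theorem reApplyInnerSelf_le_opNorm (T : E →L[𝕜] E) {x : E} (hx : ‖x‖ = 1) :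
    T.reApplyInnerSelf x ≤ ‖T‖ := by
  simpa [ContinuousLinearMap.rayleighQuotient, hx] using
    (le_abs_self _).trans (T.rayleighQuotient_le_norm x)

theorem reApplyInnerSelf_star_mul_mul [CompleteSpace E] (S T : E →L[𝕜] E) (x : E) :
    (star S * T * S).reApplyInnerSelf x = T.reApplyInnerSelf (S x) := by
  simp [ContinuousLinearMap.reApplyInnerSelf_apply, ContinuousLinearMap.star_eq_adjoint,
    ContinuousLinearMap.adjoint_inner_left]

theorem norm_inner_apply_sq_le_of_nonneg {T : E →L[𝕜] E} (hT : 0 ≤ T) (x y : E) :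
    ‖⟪T x, y⟫_𝕜‖ ^ 2 ≤ T.reApplyInnerSelf x * T.reApplyInnerSelf y := by
  have hT := (ContinuousLinearMap.nonneg_iff_isPositive T).mp hT
  let core : PreInnerProductSpace.Core 𝕜 E :=
    { inner x y := ⟪T x, y⟫_𝕜
      conj_inner_symm x y := by rw [inner_conj_symm, hT.inner_left_eq_inner_right]
      re_inner_nonneg := hT.re_inner_nonneg_left
      add_left x y z := by rw [map_add, inner_add_left]
      smul_left x y r := by rw [map_smul, inner_smul_left] }
  have h_symm : ‖⟪T y, x⟫_𝕜‖ = ‖⟪T x, y⟫_𝕜‖ := by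
    rw [hT.inner_left_eq_inner_right, norm_inner_symm]
  have h_schwarz : ‖⟪T x, y⟫_𝕜‖ * ‖⟪T y, x⟫_𝕜‖ ≤ T.reApplyInnerSelf x * T.reApplyInnerSelf y :=
    InnerProductSpace.Core.inner_mul_inner_self_le (𝕜 := 𝕜) (F := E) x y
  rwa [h_symm, ← sq] at h_schwarz

theorem norm_inner_sq_le_of_mul_eq_one {P Q : E →L[𝕜] E} (hP : 0 ≤ P) (hPQ : P * Q = 1) (x y : E) :
    ‖⟪x, y⟫_𝕜‖ ^ 2 ≤ Q.reApplyInnerSelf x * P.reApplyInnerSelf y := by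
  have hPQx : P (Q x) = x := DFunLike.congr_fun hPQ x
  have h := norm_inner_apply_sq_le_of_nonneg hP (Q x) y
  rwa [P.reApplyInnerSelf_apply (Q x), hPQx, inner_re_symm] at h

theorem four_mul_norm_inner_le_of_norm_add_smul_sq_le {x y : E} {r : ℝ}
    (h : ∀ c : 𝕜, ‖c‖ = 1 → ‖x + c • y‖ ^ 2 ≤ r) : 4 * ‖⟪x, y⟫_𝕜‖ ≤ r := by
  obtain ⟨c, hc, h_phase⟩ := RCLike.exists_norm_eq_mul_self ⟪x, y⟫_𝕜
  have h_polar := re_inner_eq_norm_add_mul_self_sub_norm_sub_mul_self_div_four (𝕜 := 𝕜) x (c • y)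
  rw [inner_smul_right, ← h_phase, ofReal_re] at h_polar
  nlinarith [h c hc, sq_nonneg ‖x - c • y‖]

end InnerProduct

section MixedSchwarz

variable {H : Type*} [NormedAddCommGroup H] [InnerProductSpace ℂ H] [CompleteSpace H]

theorem norm_inner_apply_sq_le_cfc_of_pos (T : H →L[ℂ] H) {F G : ℝ → ℝ}
    (hF : ContinuousOn F (Ici 0)) (hG : ContinuousOn G (Ici 0)) (hG_pos : ∀ u, 0 ≤ u → 0 < G u)
    (hFG : ∀ u, 0 ≤ u → u ≤ F u * G u) (x y : H) :
    ‖⟪T x, y⟫_ℂ‖ ^ 2 ≤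
      (cfc F (star T * T)).reApplyInnerSelf x * (cfc G (T * star T)).reApplyInnerSelf y := by
  have ha : spectrum ℝ (star T * T) ⊆ Ici 0 := fun _ hu =>
    spectrum_nonneg_of_nonneg (star_mul_self_nonneg T) hu
  have hb : spectrum ℝ (T * star T) ⊆ Ici 0 := fun _ hu =>
    spectrum_nonneg_of_nonneg (mul_star_self_nonneg T) hu
  have hG_inv : ContinuousOn (fun u => (G u)⁻¹) (Ici 0) := hG.inv₀ fun u hu => (hG_pos u hu).ne'
  set P := cfc G (T * star T)
  set Q := cfc (fun u => (G u)⁻¹) (T * star T)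
  have hP : 0 ≤ P := cfc_nonneg fun u hu => (hG_pos u (hb hu)).le
  have hPQ : P * Q = 1 := by
    rw [← cfc_mul _ _ _ (hG.mono hb) (hG_inv.mono hb), ← cfc_one ℝ (T * star T)]
    exact cfc_congr fun u hu => mul_inv_cancel₀ (hG_pos u (hb hu)).ne'
  have hQ : star T * Q * T ≤ cfc F (star T * T) := by
    rw [star_mul_cfc_mul_star_mul_self T (hG_inv.mono (union_subset ha hb))]
    exact cfc_mono (fun u hu => (mul_inv_le_iff₀ (hG_pos u (ha hu))).mpr (hFG u (ha hu)))
      (continuousOn_id.mul (hG_inv.mono ha)) (hF.mono ha)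
  calc ‖⟪T x, y⟫_ℂ‖ ^ 2
    _ ≤ Q.reApplyInnerSelf (T x) * P.reApplyInnerSelf y := norm_inner_sq_le_of_mul_eq_one hP hPQ _ _
    _ = (star T * Q * T).reApplyInnerSelf x * P.reApplyInnerSelf y := by
      rw [reApplyInnerSelf_star_mul_mul]
    _ ≤ (cfc F (star T * T)).reApplyInnerSelf x * P.reApplyInnerSelf y :=
      mul_le_mul_of_nonneg_right (reApplyInnerSelf_mono hQ x) (reApplyInnerSelf_nonneg hP y)

/-- **Mixed Schwarz inequality**, due to Kato for powers and to Kittaneh in general. -/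
theorem norm_inner_apply_sq_le_cfc (T : H →L[ℂ] H) {F G : ℝ → ℝ}
    (hF : ContinuousOn F (Ici 0)) (hG : ContinuousOn G (Ici 0))
    (hF_nonneg : ∀ u, 0 ≤ u → 0 ≤ F u) (hG_nonneg : ∀ u, 0 ≤ u → 0 ≤ G u)
    (hFG : ∀ u, 0 ≤ u → u ≤ F u * G u) (x y : H) :
    ‖⟪T x, y⟫_ℂ‖ ^ 2 ≤
      (cfc F (star T * T)).reApplyInnerSelf x * (cfc G (T * star T)).reApplyInnerSelf y := by
  have hb : spectrum ℝ (T * star T) ⊆ Ici 0 := fun _ hu =>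
    spectrum_nonneg_of_nonneg (mul_star_self_nonneg T) hu
  set p := (cfc F (star T * T)).reApplyInnerSelf x
  set q := (cfc G (T * star T)).reApplyInnerSelf y
  have h_shift (ε : ℝ) : (cfc (fun u => G u + ε) (T * star T)).reApplyInnerSelf y =
      q + ε * ‖y‖ ^ 2 := by
    rw [cfc_add_const ε G _ (hG.mono hb)]
    simp [q, ContinuousLinearMap.reApplyInnerSelf_apply, inner_add_left,
      Algebra.algebraMap_eq_smul_one, inner_self_eq_norm_sq_to_K, inner_smul_left_eq_smul,
      ← Complex.ofReal_pow]
  -- `G` may vanish, so apply the strictly positive case to `G + ε` and let `ε → 0`.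
  have h_perturbed : ∀ ε > 0, ‖⟪T x, y⟫_ℂ‖ ^ 2 ≤ p * (q + ε * ‖y‖ ^ 2) := fun ε hε => by
    rw [← h_shift]
    refine norm_inner_apply_sq_le_cfc_of_pos T hF (hG.add continuousOn_const)
      (fun u hu => add_pos_of_nonneg_of_pos (hG_nonneg u hu) hε) (fun u hu => ?_) x y
    exact (hFG u hu).trans
      (mul_le_mul_of_nonneg_left (le_add_of_nonneg_right hε.le) (hF_nonneg u hu))
  have h_lim : Filter.Tendsto (fun ε : ℝ => p * (q + ε * ‖y‖ ^ 2)) (nhdsWithin 0 (Ioi 0))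
      (nhds (p * q)) :=
    tendsto_nhdsWithin_of_tendsto_nhds <| Continuous.tendsto' (by fun_prop) _ _ (by simp)
  exact ge_of_tendsto h_lim (eventually_nhdsWithin_of_forall h_perturbed)

theorem norm_sum_sq_le_norm_sum_cfc {ι : Type*} (s : Finset ι) (T : ι → H →L[ℂ] H) {F G : ℝ → ℝ}
    (hF : ContinuousOn F (Ici 0)) (hG : ContinuousOn G (Ici 0))
    (hF_nonneg : ∀ u, 0 ≤ u → 0 ≤ F u) (hG_nonneg : ∀ u, 0 ≤ u → 0 ≤ G u)
    (hFG : ∀ u, 0 ≤ u → u ≤ F u * G u) :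
    ‖∑ i ∈ s, T i‖ ^ 2 ≤
      ‖∑ i ∈ s, cfc F (star (T i) * T i)‖ * ‖∑ i ∈ s, cfc G (T i * star (T i))‖ := by
  rw [← Real.le_sqrt (norm_nonneg _) (by positivity)]
  refine ContinuousLinearMap.opNorm_le_of_re_inner_le (Real.sqrt_nonneg _) fun x y hx hy => ?_
  have hP (i : ι) : 0 ≤ (cfc F (star (T i) * T i)).reApplyInnerSelf x :=
    reApplyInnerSelf_nonneg (cfc_nonneg fun u hu =>
      hF_nonneg u (spectrum_nonneg_of_nonneg (star_mul_self_nonneg (T i)) hu)) x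
  have hQ (i : ι) : 0 ≤ (cfc G (T i * star (T i))).reApplyInnerSelf y :=
    reApplyInnerSelf_nonneg (cfc_nonneg fun u hu =>
      hG_nonneg u (spectrum_nonneg_of_nonneg (mul_star_self_nonneg (T i)) hu)) y
  have h_re : re ⟪(∑ i ∈ s, T i) x, y⟫_ℂ ≤ ∑ i ∈ s, ‖⟪T i x, y⟫_ℂ‖ := by
    rw [sum_apply, sum_inner]
    exact (re_le_norm _).trans (norm_sum_le _ _)
  refine h_re.trans (Real.le_sqrt_of_sq_le ?_)
  calc (∑ i ∈ s, ‖⟪T i x, y⟫_ℂ‖) ^ 2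
    _ ≤ (∑ i ∈ s, (cfc F (star (T i) * T i)).reApplyInnerSelf x) *
        ∑ i ∈ s, (cfc G (T i * star (T i))).reApplyInnerSelf y :=
      Finset.sum_sq_le_sum_mul_sum_of_sq_le_mul s (fun i _ => hP i) (fun i _ => hQ i) fun i _ =>
        norm_inner_apply_sq_le_cfc (T i) hF hG hF_nonneg hG_nonneg hFG x y
    _ ≤ _ := by
      refine mul_le_mul ?_ ?_ (Finset.sum_nonneg fun i _ => hQ i) (norm_nonneg _)
      · exact (sum_reApplyInnerSelf _ _ _).trans_le (reApplyInnerSelf_le_opNorm _ hx)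
      · exact (sum_reApplyInnerSelf _ _ _).trans_le (reApplyInnerSelf_le_opNorm _ hy)

theorem norm_sum_sq_le_norm_sum_abs_rpow {ι : Type*} (s : Finset ι) (T : ι → H →L[ℂ] H) {p q : ℝ}
    (hp : 0 ≤ p) (hq : 0 ≤ q) (hpq : p + q = 1) :
    ‖∑ i ∈ s, T i‖ ^ 2 ≤
      ‖∑ i ∈ s, CFC.abs (T i) ^ (2 * p)‖ * ‖∑ i ∈ s, CFC.abs (star (T i)) ^ (2 * q)‖ := by
  simp_rw [abs_rpow_two_mul _ hp, abs_rpow_two_mul _ hq, star_star]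
  refine norm_sum_sq_le_norm_sum_cfc s T (Real.continuous_rpow_const hp).continuousOn
    (Real.continuous_rpow_const hq).continuousOn (fun u hu => Real.rpow_nonneg hu p)
    (fun u hu => Real.rpow_nonneg hu q) fun u hu => ?_
  rw [← Real.rpow_add_of_nonneg hu hp hq, hpq, Real.rpow_one]

end MixedSchwarz

section NumericalRadius

variable {H : Type*} [NormedAddCommGroup H] [InnerProductSpace ℂ H]

theorem norm_inner_apply_self_le_numericalRadius (T : H →L[ℂ] H) {x : H} (hx : ‖x‖ = 1) :
    ‖⟪T x, x⟫_ℂ‖ ≤ numericalRadius T :=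
  le_csSup (numericalRadius_bddAbove T) ⟨x, hx, rfl⟩

theorem numericalRadius_nonneg (T : H →L[ℂ] H) : 0 ≤ numericalRadius T :=
  Real.sSup_nonneg (by rintro _ ⟨x, -, rfl⟩; exact norm_nonneg _)

theorem numericalRadius_le {T : H →L[ℂ] H} {r : ℝ} (hr : 0 ≤ r)
    (h : ∀ x : H, ‖x‖ = 1 → ‖⟪T x, x⟫_ℂ‖ ≤ r) : numericalRadius T ≤ r :=
  Real.sSup_le (by rintro _ ⟨x, hx, rfl⟩; exact h x hx) hr

theorem numericalRadius_add_le (S T : H →L[ℂ] H) :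
    numericalRadius (S + T) ≤ numericalRadius S + numericalRadius T := by
  refine numericalRadius_le (add_nonneg (numericalRadius_nonneg S) (numericalRadius_nonneg T))
    fun x hx => ?_
  rw [add_apply, inner_add_left]
  exact norm_add_le_of_le (norm_inner_apply_self_le_numericalRadius S hx)
    (norm_inner_apply_self_le_numericalRadius T hx)

theorem numericalRadius_neg (T : H →L[ℂ] H) : numericalRadius (-T) = numericalRadius T := by
  simp [numericalRadius]

theorem numericalRadius_sub_le (S T : H →L[ℂ] H) :
    numericalRadius (S - T) ≤ numericalRadius S + numericalRadius T := by
  simpa [sub_eq_add_neg, numericalRadius_neg] using numericalRadius_add_le S (-T)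

variable [CompleteSpace H]

theorem numericalRadius_mul_le_of_norm_star_add_smul_sq_le {A B : H →L[ℂ] H} {r : ℝ}
    (h : ∀ c : ℂ, ‖c‖ = 1 → ‖star A + c • B‖ ^ 2 ≤ r) : numericalRadius (A * B) ≤ 1 / 4 * r := by
  have hr : 0 ≤ r := (sq_nonneg _).trans (h 1 norm_one)
  refine numericalRadius_le (by positivity) fun x hx => ?_
  have h_inner : ‖⟪(A * B) x, x⟫_ℂ‖ = ‖⟪star A x, B x⟫_ℂ‖ := by
    rw [norm_inner_symm, ContinuousLinearMap.star_eq_adjoint,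
      ContinuousLinearMap.adjoint_inner_left, mul_apply_eq_comp]
  have h_vec (c : ℂ) (hc : ‖c‖ = 1) : ‖star A x + c • B x‖ ^ 2 ≤ r := by
    refine le_trans ?_ (h c hc)
    gcongr
    exact (star A + c • B).unit_le_opNorm x hx.le
  linarith [four_mul_norm_inner_le_of_norm_add_smul_sq_le h_vec]

theorem numericalRadius_mul_le (A B : H →L[ℂ] H) {p q : ℝ} (hp : 0 ≤ p) (hq : 0 ≤ q)
    (hpq : p + q = 1) :
    numericalRadius (A * B) ≤ 1 / 4 *
      (‖CFC.abs A ^ (2 * p) + CFC.abs (star B) ^ (2 * p)‖ *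
        ‖CFC.abs (star A) ^ (2 * q) + CFC.abs B ^ (2 * q)‖) := by
  refine numericalRadius_mul_le_of_norm_star_add_smul_sq_le fun c hc => ?_
  have h := norm_sum_sq_le_norm_sum_abs_rpow Finset.univ ![star A, c • B] hq hp
    ((add_comm q p).trans hpq)
  simpa [Fin.sum_univ_two, hc, mul_comm] using h

theorem numericalRadius_mul_le_iInf (A B : H →L[ℂ] H) :
    numericalRadius (A * B) ≤ 1 / 4 * ⨅ t : Icc (0 : ℝ) 1,
      ‖CFC.abs A ^ (2 * (t : ℝ)) + CFC.abs (star B) ^ (2 * (t : ℝ))‖ *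
        ‖CFC.abs (star A) ^ (2 * (1 - (t : ℝ))) + CFC.abs B ^ (2 * (1 - (t : ℝ)))‖ := by
  rw [Real.mul_iInf_of_nonneg (by norm_num)]
  exact le_ciInf fun t =>
    numericalRadius_mul_le A B t.2.1 (sub_nonneg.mpr t.2.2) (add_sub_cancel _ _)

end NumericalRadius

theorem theorem2p14 {H : Type*} [NormedAddCommGroup H] [InnerProductSpace ℂ H] [CompleteSpace H]
    (A B C D : H →L[ℂ] H) :
    numericalRadius (A * B + C * D) ≤
        1 / 4 *
          ((⨅ t : Set.Icc (0 : ℝ) 1,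
              ‖CFC.abs A ^ (2 * (t : ℝ)) + CFC.abs (star B) ^ (2 * (t : ℝ))‖ *
                ‖CFC.abs (star A) ^ (2 * (1 - (t : ℝ))) + CFC.abs B ^ (2 * (1 - (t : ℝ)))‖) +
            ⨅ t : Set.Icc (0 : ℝ) 1,
              ‖CFC.abs C ^ (2 * (t : ℝ)) + CFC.abs (star D) ^ (2 * (t : ℝ))‖ *
                ‖CFC.abs (star C) ^ (2 * (1 - (t : ℝ))) + CFC.abs D ^ (2 * (1 - (t : ℝ)))‖) ∧
      numericalRadius (A * B - C * D) ≤
        1 / 4 *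
          ((⨅ t : Set.Icc (0 : ℝ) 1,
              ‖CFC.abs A ^ (2 * (t : ℝ)) + CFC.abs (star B) ^ (2 * (t : ℝ))‖ *
                ‖CFC.abs (star A) ^ (2 * (1 - (t : ℝ))) + CFC.abs B ^ (2 * (1 - (t : ℝ)))‖) +
            ⨅ t : Set.Icc (0 : ℝ) 1,
              ‖CFC.abs C ^ (2 * (t : ℝ)) + CFC.abs (star D) ^ (2 * (t : ℝ))‖ *
                ‖CFC.abs (star C) ^ (2 * (1 - (t : ℝ))) + CFC.abs D ^ (2 * (1 - (t : ℝ)))‖) := by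
  rw [mul_add]
  have h_sum := add_le_add (numericalRadius_mul_le_iInf A B) (numericalRadius_mul_le_iInf C D)
  exact ⟨(numericalRadius_add_le _ _).trans h_sum, (numericalRadius_sub_le _ _).trans h_sum⟩
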